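/- Let $R$ be a nonzero (associative, unital) ring, $N$ an $R$-$R$-bimodule, and $T=T_R(N)=\bigoplus_{i\ge 0}N^{i}$ the tensor ring, where $N^{0}=R$ and $N^{i+1}=N\otimes_R N^{i}$. All modules are left modules. Put $M'=\bigoplus_{i\ge 1}N^{i}$, so that $T=R\oplus M'$. A $T$-module is identified with a pair $(X,\alpha)$, where $X$ is its underlying $R$-module and $\alpha\colon M'\otimes_R X\to X$, $m\otimes x\mapsto mx$, is the action of $M'$. Let $l=T\otimes_R-\colon \operatorname{Mod}R\to\operatorname{Mod}T$, and let $q\colon\operatorname{Mod}T\to\operatorname{Mod}R$ be the functor with $q(X,\alpha)=\operatorname{Coker}(\alpha)$ which sends a $T$-linear map to the induced map of cokernels (so $ql\cong\mathrm{Id}$). For a homomorphism $\sigma\colon Q_1\to Q_0$ of modules over a ring, let $\mathcal D_\sigma$ be the class of all modules $L$ for which $\operatorname{Hom}(\sigma,L)\colon\operatorname{Hom}(Q_0,L)\to\operatorname{Hom}(Q_1,L)$ is surjective, and let $\operatorname{Gen}(Y)$ be the class of all quotients of direct sums of copies of $Y$. A projective presentation of $Y$ is an exact sequence $Q_1\xrightarrow{\sigma}Q_0\to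 Y\to 0$ with $Q_1,Q_0$ projective. Given such a presentation, $Y$ is *partial silting with respect to $\sigma$* if $Y\in\mathcal D_\sigma$ and $\mathcal D_\sigma$ is a torsion class (closed under epimorphic images, extensions and direct sums), and $Y$ is *silting with respect to $\sigma$* if $\operatorname{Gen}(Y)=\mathcal D_\sigma$. Let $P_1,P_0$ be $R$-modules and let $l(P_1)\xrightarrow{\delta}l(P_0)\to(X,\alpha)\to 0$ be a projective presentation of a $T$-module $(X,\alpha)$. (1) If $(X,\alpha)$ is partial silting with respect to $\delta$, then $\operatorname{Coker}(\alpha)$ is a partial silting $R$-module with respect to $q(\delta)$. (2) If $(X,\alpha)$ is silting with respect to $\delta$, then $\operatorname{Coker}(\alpha)$ is a silting $R$-module with respect to $q(\delta)$. In both cases this includes that $q(\delta)\colon ql(P_1)\to ql(P_0)$ is the map of a projective presentation of $\operatorname{Coker}(\alpha)$. -/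

import Mathlib

open CategoryTheory CategoryTheory.Limits
open scoped TensorProduct DirectSum

universe w v u

noncomputable section

namespace TensorRingSilting

/-! ### Silting objects in abelian categories -/

section Silting

variable {C : Type u} [Category.{v} C] [Abelian C]

/-- `P₁ ⟶ P₀ ⟶ X ⟶ 0` (with maps `σ`, `π`) is a projective presentation of `X`. -/
structure IsProjectivePresentation {P₁ P₀ X : C} (σ : P₁ ⟶ P₀) (π : P₀ ⟶ X) : Prop where
  projective₁ : Projective P₁
  projective₀ : Projective P₀
  epi : Epi π
  zero : σ ≫ π = 0
  exact : (ShortComplex.mk σ π zero).Exact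

/-- The class `𝒟_σ` of all objects `L` such that `Hom(σ, L)` is surjective. -/
def classD {P₁ P₀ : C} (σ : P₁ ⟶ P₀) : ObjectProperty C :=
  fun L => Function.Surjective (fun g : P₀ ⟶ L => σ ≫ g)

/-- The class `Gen(X)` of all quotients of coproducts of copies of `X`. -/
def gen [HasCoproducts.{w} C] (X : C) : ObjectProperty C :=
  fun L => ∃ (J : Type w) (f : (∐ fun _ : J => X) ⟶ L), Epi f

/-- A torsion class: closed under epimorphic images, extensions and (small) coproducts. -/
structure IsTorsionClass (𝒯 : ObjectProperty C) : Prop where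
  quotients : 𝒯.IsClosedUnderQuotients
  extensions : 𝒯.IsClosedUnderExtensions
  coproducts : ∀ J : Type w, 𝒯.IsClosedUnderColimitsOfShape (Discrete J)

/-- `X` is partial silting with respect to `σ`, where `σ` is the map of a projective
presentation of `X`. -/
structure IsPartialSilting {P₁ P₀ : C} (σ : P₁ ⟶ P₀) (X : C) : Prop where
  presentation : ∃ π : P₀ ⟶ X, IsProjectivePresentation σ π
  mem : classD σ X
  torsion : IsTorsionClass.{w} (classD σ)

/-- `X` is silting with respect to `σ`, where `σ` is the map of a projective
presentation of `X`. -/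
structure IsSilting [HasCoproducts.{w} C] {P₁ P₀ : C} (σ : P₁ ⟶ P₀) (X : C) : Prop where
  presentation : ∃ π : P₀ ⟶ X, IsProjectivePresentation σ π
  gen_eq : gen.{w} X = classD σ

end Silting

/-! ### The tensor product of a right and a left module over a noncommutative ring

A right `R`-module is a module over `Rᵐᵒᵖ`, the right action being `a · r = op r • a`. -/

section BalTensor

variable (R : Type*) [Ring R] (A : Type*) [AddCommGroup A] [Module Rᵐᵒᵖ A]
  (B : Type*) [AddCommGroup B] [Module R B]

/-- The relations `a r ⊗ b - a ⊗ r b`. -/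
def balRel : Submodule ℤ (A ⊗[ℤ] B) :=
  Submodule.span ℤ {z | ∃ (a : A) (r : R) (b : B),
    z = (MulOpposite.op r • a) ⊗ₜ[ℤ] b - a ⊗ₜ[ℤ] (r • b)}

/-- `A ⊗_R B` for a right `R`-module `A` and a left `R`-module `B`. -/
def BalTensor : Type _ := (A ⊗[ℤ] B) ⧸ balRel R A B

instance : AddCommGroup (BalTensor R A B) :=
  inferInstanceAs (AddCommGroup ((A ⊗[ℤ] B) ⧸ balRel R A B))

namespace BalTensor

variable {A B}

/-- The elementary tensor `a ⊗ b` in `A ⊗_R B`. -/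
def tmul (a : A) (b : B) : BalTensor R A B := (balRel R A B).mkQ (a ⊗ₜ[ℤ] b)

theorem add_tmul (a a' : A) (b : B) : tmul R (a + a') b = tmul R a b + tmul R a' b := by
  simp only [tmul, TensorProduct.add_tmul, map_add]; rfl

theorem tmul_add (a : A) (b b' : B) : tmul R a (b + b') = tmul R a b + tmul R a b' := by
  simp only [tmul, TensorProduct.tmul_add, map_add]; rfl

@[simp] theorem zero_tmul (b : B) : tmul R (0 : A) b = 0 := by
  have h := add_tmul R (0 : A) 0 b
  rwa [add_zero, left_eq_add] at h

@[simp] theorem tmul_zero (a : A) : tmul R a (0 : B) = 0 := by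
  have h := tmul_add R a (0 : B) 0
  rwa [add_zero, left_eq_add] at h

theorem op_smul_tmul (a : A) (r : R) (b : B) :
    tmul R (MulOpposite.op r • a) b = tmul R a (r • b) :=
  (Submodule.Quotient.eq _).2 (Submodule.subset_span ⟨a, r, b, rfl⟩)

@[elab_as_elim]
theorem induction {p : BalTensor R A B → Prop} (z : BalTensor R A B) (zero : p 0)
    (tmul : ∀ a b, p (tmul R a b)) (add : ∀ x y, p x → p y → p (x + y)) : p z := by
  obtain ⟨t, rfl⟩ := (balRel R A B).mkQ_surjective z
  induction t using TensorProduct.induction_on with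
  | zero => rw [map_zero]; exact zero
  | tmul a b => exact tmul a b
  | add x y hx hy => rw [map_add]; exact add _ _ hx hy

variable {R} {E : Type*} [AddCommGroup E]

/-- The additive map on `A ⊗_R B` given by a balanced biadditive map. -/
def lift (f : A →+ B →+ E) (hf : ∀ a (r : R) b, f (MulOpposite.op r • a) b = f a (r • b)) :
    BalTensor R A B →+ E :=
  ((balRel R A B).liftQ (TensorProduct.liftAddHom f (fun n a b => by
      rw [map_zsmul, map_zsmul, AddMonoidHom.smul_apply])).toIntLinearMap (by
    rw [balRel, Submodule.span_le]
    rintro _ ⟨a, r, b, rfl⟩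
    simp [hf])).toAddMonoidHom

@[simp] theorem lift_tmul (f : A →+ B →+ E)
    (hf : ∀ a (r : R) b, f (MulOpposite.op r • a) b = f a (r • b)) (a : A) (b : B) :
    lift f hf (tmul R a b) = f a b :=
  TensorProduct.liftAddHom_tmul (R := ℤ) f (fun n a b => by
    rw [map_zsmul, map_zsmul, AddMonoidHom.smul_apply]) a b

theorem hom_ext {f g : BalTensor R A B →+ E} (h : ∀ a b, f (tmul R a b) = g (tmul R a b)) :
    f = g := by
  ext z
  induction z using induction with
  | zero => simp
  | tmul a b => exact h a b
  | add x y hx hy => rw [map_add, map_add, hx, hy]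

variable (R)

/-- `(a, b) ↦ a ⊗ b` as a biadditive map. -/
def mk₂ : A →+ B →+ BalTensor R A B :=
  AddMonoidHom.mk' (fun a => AddMonoidHom.mk' (fun b => tmul R a b) (tmul_add R a))
    (fun a a' => by ext b; exact add_tmul R a a' b)

@[simp] theorem mk₂_apply (a : A) (b : B) : mk₂ R a b = tmul R a b := rfl

section Left

variable {S : Type*} [Ring S] [Module S A] [SMulCommClass S Rᵐᵒᵖ A]

/-- The additive endomorphism `a ⊗ b ↦ s a ⊗ b`. -/
def leftEnd (s : S) : BalTensor R A B →+ BalTensor R A B :=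
  lift ((mk₂ R).comp (DistribSMul.toAddMonoidHom A s))
    (fun a r b => by simp [smul_comm s, op_smul_tmul])

@[simp] theorem leftEnd_tmul (s : S) (a : A) (b : B) :
    leftEnd R s (tmul R a b) = tmul R (s • a) b :=
  lift_tmul _ _ a b

/-- If `A` is an `S`-`R`-bimodule, then `A ⊗_R B` is a left `S`-module. -/
instance : Module S (BalTensor R A B) where
  smul s z := leftEnd R s z
  one_smul z := DFunLike.congr_fun
    (hom_ext (f := leftEnd R (1 : S)) (g := AddMonoidHom.id _) (by simp)) z
  mul_smul s t z := DFunLike.congr_fun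
    (hom_ext (f := leftEnd R (s * t)) (g := (leftEnd R s).comp (leftEnd R t))
      (by simp [mul_smul])) z
  smul_zero s := map_zero (leftEnd R s)
  smul_add s := map_add (leftEnd R s)
  add_smul s t z := DFunLike.congr_fun
    (hom_ext (f := leftEnd R (s + t)) (g := leftEnd R s + leftEnd R t)
      (by simp [add_smul, add_tmul])) z
  zero_smul z := DFunLike.congr_fun
    (hom_ext (f := leftEnd R (0 : S)) (g := 0) (by simp)) z

theorem smul_tmul (s : S) (a : A) (b : B) : s • tmul R a b = tmul R (s • a) b :=
  leftEnd_tmul R s a b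

end Left

section Right

variable {S : Type*} [Ring S] [Module Sᵐᵒᵖ B] [SMulCommClass R Sᵐᵒᵖ B]

/-- The additive endomorphism `a ⊗ b ↦ a ⊗ b s`. -/
def rightEnd (s : Sᵐᵒᵖ) : BalTensor R A B →+ BalTensor R A B :=
  lift (AddMonoidHom.mk' (fun a => (mk₂ R a).comp (DistribSMul.toAddMonoidHom B s))
      (fun a a' => by ext b; simp))
    (fun a r b => by simp [smul_comm r s, op_smul_tmul])

@[simp] theorem rightEnd_tmul (s : Sᵐᵒᵖ) (a : A) (b : B) :
    rightEnd R s (tmul R a b) = tmul R a (s • b) :=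
  lift_tmul _ _ a b

/-- If `B` is an `R`-`S`-bimodule, then `A ⊗_R B` is a right `S`-module. -/
abbrev rightModule : Module Sᵐᵒᵖ (BalTensor R A B) where
  smul s z := rightEnd R s z
  one_smul z := DFunLike.congr_fun
    (hom_ext (f := rightEnd R (1 : Sᵐᵒᵖ)) (g := AddMonoidHom.id _) (by simp)) z
  mul_smul s t z := DFunLike.congr_fun
    (hom_ext (f := rightEnd R (s * t)) (g := (rightEnd R s).comp (rightEnd R t))
      (by simp [mul_smul])) z
  smul_zero s := map_zero (rightEnd R s)
  smul_add s := map_add (rightEnd R s)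
  add_smul s t z := DFunLike.congr_fun
    (hom_ext (f := rightEnd R (s + t)) (g := rightEnd R s + rightEnd R t)
      (by simp [add_smul, tmul_add])) z
  zero_smul z := DFunLike.congr_fun
    (hom_ext (f := rightEnd R (0 : Sᵐᵒᵖ)) (g := 0) (by simp)) z

theorem rightModule_smul_tmul (s : Sᵐᵒᵖ) (a : A) (b : B) :
    letI := rightModule R (A := A) (B := B) (S := S)
    s • tmul R a b = tmul R a (s • b) :=
  rightEnd_tmul R s a b

end Right

end BalTensor

end BalTensor

/-! ### The tensor ring of a bimodule -/

/-- A bundled `R`-`R`-bimodule. -/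
structure Bimodule (R : Type u) [Ring R] where
  carrier : Type u
  [addCommGroup : AddCommGroup carrier]
  [left : Module R carrier]
  [right : Module Rᵐᵒᵖ carrier]
  [comm : SMulCommClass R Rᵐᵒᵖ carrier]

attribute [instance] Bimodule.addCommGroup Bimodule.left Bimodule.right Bimodule.comm

section TensorRing

variable (R : Type u) [Ring R] (N : Type u) [AddCommGroup N] [Module R N] [Module Rᵐᵒᵖ N]
  [SMulCommClass R Rᵐᵒᵖ N]

/-- The tensor product `N ⊗_R V` of bimodules. -/
def tensorBimodule (V : Bimodule R) : Bimodule R :=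
  letI := BalTensor.rightModule R (A := N) (B := V.carrier) (S := R)
  { carrier := BalTensor R N V.carrier
    comm := ⟨fun r s z => by
      induction z using BalTensor.induction with
      | zero => simp
      | tmul a b =>
        rw [BalTensor.rightModule_smul_tmul, BalTensor.smul_tmul, BalTensor.smul_tmul,
          BalTensor.rightModule_smul_tmul]
      | add x y hx hy => simp only [smul_add, hx, hy]⟩ }

/-- The tensor powers as bundled bimodules: `N⁰ = R` and `Nⁱ⁺¹ = N ⊗_R Nⁱ`. -/
def powBimodule : ℕ → Bimodule R
  | 0 => { carrier := R }
  | i + 1 => tensorBimodule R N (powBimodule i)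

/-- The `i`-th tensor power of the bimodule `N`. -/
abbrev TPow (i : ℕ) : Type u := (powBimodule R N i).carrier

/-- An element of `R`, seen in `N⁰ = R`. -/
def pow0 : R →+ TPow R N 0 := AddMonoidHom.id R

theorem pow0_surjective : Function.Surjective (pow0 R N) := fun x => ⟨x, rfl⟩

theorem pow0_smul (r s : R) : pow0 R N (r * s) = r • pow0 R N s := rfl

theorem pow0_op_smul (r s : R) : pow0 R N (s * r) = MulOpposite.op r • pow0 R N s := rfl

/-- The biadditive map `(n, x) ↦ n ⊗ x`, `N × Nⁱ → Nⁱ⁺¹`. -/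
def cons (i : ℕ) : N →+ TPow R N i →+ TPow R N (i + 1) :=
  BalTensor.mk₂ R (A := N) (B := TPow R N i)

theorem cons_smul (i : ℕ) (r : R) (n : N) (x : TPow R N i) :
    cons R N i (r • n) x = r • cons R N i n x :=
  (BalTensor.smul_tmul R r n x).symm

theorem cons_op_smul (i : ℕ) (r : R) (n : N) (x : TPow R N i) :
    cons R N i n (MulOpposite.op r • x) = MulOpposite.op r • cons R N i n x :=
  (BalTensor.rightModule_smul_tmul R (MulOpposite.op r) n x).symm

theorem cons_balanced (i : ℕ) (r : R) (n : N) (x : TPow R N i) :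
    cons R N i (MulOpposite.op r • n) x = cons R N i n (r • x) :=
  BalTensor.op_smul_tmul R n r x

/-- The additive map on `Nⁱ⁺¹ = N ⊗_R Nⁱ` given by a balanced biadditive map. -/
def consLift (i : ℕ) {E : Type*} [AddCommGroup E] (f : N →+ TPow R N i →+ E)
    (hf : ∀ n (r : R) x, f (MulOpposite.op r • n) x = f n (r • x)) : TPow R N (i + 1) →+ E :=
  BalTensor.lift (R := R) f hf

theorem consLift_cons (i : ℕ) {E : Type*} [AddCommGroup E] (f : N →+ TPow R N i →+ E)
    (hf : ∀ n (r : R) x, f (MulOpposite.op r • n) x = f n (r • x)) (n : N) (x : TPow R N i) :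
    consLift R N i f hf (cons R N i n x) = f n x :=
  BalTensor.lift_tmul f hf n x

theorem pow_succ_induction (i : ℕ) {p : TPow R N (i + 1) → Prop} (z : TPow R N (i + 1))
    (zero : p 0) (tmul : ∀ n x, p (cons R N i n x)) (add : ∀ x y, p x → p y → p (x + y)) :
    p z :=
  BalTensor.induction (R := R) (A := N) (B := TPow R N i) z zero tmul add

/-- The tensor ring `T_R(N) = ⨁ᵢ Nⁱ`. -/
def TensorRing : Type u := ⨁ i, TPow R N i

/-- The bimodule `M' = ⨁ᵢ Nⁱ⁺¹ = N ⊕ N² ⊕ ⋯` of elements of positive degree, for which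
`T_R(N) = R ⊕ M'` is a `θ`-extension of `R`. -/
abbrev PosPart : Type u := ⨁ i, TPow R N (i + 1)

namespace TensorRing

instance : AddCommGroup (TensorRing R N) := inferInstanceAs (AddCommGroup (⨁ i, TPow R N i))
instance : Module R (TensorRing R N) := inferInstanceAs (Module R (⨁ i, TPow R N i))
instance : Module Rᵐᵒᵖ (TensorRing R N) := inferInstanceAs (Module Rᵐᵒᵖ (⨁ i, TPow R N i))
instance : SMulCommClass R Rᵐᵒᵖ (TensorRing R N) :=
  inferInstanceAs (SMulCommClass R Rᵐᵒᵖ (⨁ i, TPow R N i))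

/-- The inclusion `Nⁱ → T_R(N)`. -/
def of (i : ℕ) : TPow R N i →+ TensorRing R N := DirectSum.of (fun i => TPow R N i) i

theorem of_smul (i : ℕ) (r : R) (x : TPow R N i) : of R N i (r • x) = r • of R N i x :=
  (DirectSum.lof R ℕ (fun i => TPow R N i) i).map_smul r x

theorem of_op_smul (i : ℕ) (r : Rᵐᵒᵖ) (x : TPow R N i) : of R N i (r • x) = r • of R N i x :=
  (DirectSum.lof Rᵐᵒᵖ ℕ (fun i => TPow R N i) i).map_smul r x

/-- The additive map on `T_R(N)` given by additive maps on all `Nⁱ`. -/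
def lift {E : Type*} [AddCommGroup E] (f : ∀ i, TPow R N i →+ E) : TensorRing R N →+ E :=
  DirectSum.toAddMonoid f

@[simp] theorem lift_of {E : Type*} [AddCommGroup E] (f : ∀ i, TPow R N i →+ E) (i : ℕ)
    (x : TPow R N i) : lift R N f (of R N i x) = f i x :=
  DirectSum.toAddMonoid_of f i x

@[elab_as_elim]
theorem induction {p : TensorRing R N → Prop} (z : TensorRing R N) (zero : p 0)
    (of : ∀ i x, p (of R N i x)) (add : ∀ x y, p x → p y → p (x + y)) : p z :=
  DirectSum.induction_on z zero of add

/-- The operator `n ⊗ -` on `T_R(N)`; it maps `Nⁱ` to `Nⁱ⁺¹` and is right `R`-linear. -/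
def consOp : N →+ Module.End Rᵐᵒᵖ (TensorRing R N) :=
  AddMonoidHom.mk' (fun n =>
    { toFun := lift R N (fun i => (of R N (i + 1)).comp (cons R N i n))
      map_add' := map_add _
      map_smul' := fun r z => by
        induction z using induction with
        | zero => simp
        | of i x =>
          have h := cons_op_smul R N i r.unop n x
          rw [MulOpposite.op_unop] at h
          simp only [RingHom.id_apply, lift_of, AddMonoidHom.comp_apply, ← of_op_smul, h]
        | add x y hx hy => simp only [smul_add, map_add, hx, hy] })
    (fun n n' => by
      ext z
      induction z using induction with
      | zero => simp
      | of i x => simp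
      | add x y hx hy => rw [map_add, map_add, hx, hy])

@[simp] theorem consOp_of (n : N) (i : ℕ) (x : TPow R N i) :
    consOp R N n (of R N i x) = of R N (i + 1) (cons R N i n x) :=
  lift_of R N (fun i => (of R N (i + 1)).comp (cons R N i n)) i x

/-- The operator of left multiplication by a scalar `r` on `T_R(N)`. -/
def scalarOp : R →+* Module.End Rᵐᵒᵖ (TensorRing R N) := Module.toModuleEnd Rᵐᵒᵖ _

@[simp] theorem scalarOp_apply (r : R) (z : TensorRing R N) : scalarOp R N r z = r • z := rfl

theorem consOp_op_smul (r : R) (n : N) :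
    consOp R N (MulOpposite.op r • n) = consOp R N n * scalarOp R N r := by
  ext z
  induction z using induction with
  | zero => simp
  | of i x => simp [cons_balanced, ← of_smul]
  | add x y hx hy => rw [map_add, map_add, hx, hy]

theorem consOp_smul (r : R) (n : N) :
    consOp R N (r • n) = scalarOp R N r * consOp R N n := by
  ext z
  induction z using induction with
  | zero => simp
  | of i x => simp [cons_smul, ← of_smul]
  | add x y hx hy => rw [map_add, map_add, hx, hy]

/-- The biadditive map `(n, x) ↦ (n ⊗ -) ∘ f(x)`. -/
def stepAux (i : ℕ) (f : TPow R N i →+ Module.End Rᵐᵒᵖ (TensorRing R N)) :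
    N →+ TPow R N i →+ Module.End Rᵐᵒᵖ (TensorRing R N) :=
  AddMonoidHom.mk' (fun n => (AddMonoidHom.mulLeft (consOp R N n)).comp f)
    (fun n n' => by ext1 x; simp [add_mul])

theorem stepAux_apply (i : ℕ) (f : TPow R N i →+ Module.End Rᵐᵒᵖ (TensorRing R N))
    (n : N) (x : TPow R N i) : stepAux R N i f n x = consOp R N n * f x := rfl

/-- Left multiplication by an element of `Nⁱ` on `T_R(N)`, with its compatibility with the
left `R`-action; it satisfies `(n ⊗ x) · z = n ⊗ (x · z)`. -/
def mulOpAux : ∀ i, { f : TPow R N i →+ Module.End Rᵐᵒᵖ (TensorRing R N) //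
    ∀ (r : R) x, f (r • x) = scalarOp R N r * f x }
  | 0 => ⟨(scalarOp R N).toAddMonoidHom, (scalarOp R N).map_mul⟩
  | i + 1 =>
    ⟨consLift R N i (stepAux R N i (mulOpAux i).1) (fun n r x => by
      rw [stepAux_apply, stepAux_apply, consOp_op_smul, (mulOpAux i).2, mul_assoc]),
    fun r z => by
      induction z using pow_succ_induction with
      | zero => rw [smul_zero, map_zero, mul_zero]
      | tmul n x =>
        rw [← cons_smul, consLift_cons, consLift_cons, stepAux_apply, stepAux_apply,
          consOp_smul, mul_assoc]
      | add x y hx hy => rw [smul_add, map_add, map_add, mul_add, hx, hy]⟩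

/-- Left multiplication on `T_R(N)`: concatenation of tensors. -/
def mulOp : TensorRing R N →+ Module.End Rᵐᵒᵖ (TensorRing R N) :=
  lift R N (fun i => (mulOpAux R N i).1)

theorem mulOp_of_zero (r : R) : mulOp R N (of R N 0 (pow0 R N r)) = scalarOp R N r :=
  lift_of R N (fun i => (mulOpAux R N i).1) 0 (pow0 R N r)

theorem mulOp_of_cons (i : ℕ) (n : N) (x : TPow R N i) :
    mulOp R N (of R N (i + 1) (cons R N i n x)) = consOp R N n * mulOp R N (of R N i x) := by
  rw [mulOp, lift_of, lift_of]
  exact consLift_cons R N i (stepAux R N i (mulOpAux R N i).1) (fun n r x => by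
      rw [stepAux_apply, stepAux_apply, consOp_op_smul, (mulOpAux R N i).2, mul_assoc]) n x

theorem mulOp_smul (r : R) (z : TensorRing R N) :
    mulOp R N (r • z) = scalarOp R N r * mulOp R N z := by
  induction z using induction with
  | zero => simp
  | of i x => rw [← of_smul, mulOp, lift_of, lift_of, (mulOpAux R N i).2]
  | add x y hx hy => rw [smul_add, map_add, map_add, mul_add, hx, hy]

theorem mulOp_consOp (n : N) (z : TensorRing R N) :
    mulOp R N (consOp R N n z) = consOp R N n * mulOp R N z := by
  induction z using induction with
  | zero => simp
  | of i x => rw [consOp_of, mulOp_of_cons]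
  | add x y hx hy => rw [map_add, map_add, map_add, mul_add, hx, hy]

instance : One (TensorRing R N) := ⟨of R N 0 (pow0 R N 1)⟩
instance : Mul (TensorRing R N) := ⟨fun x y => mulOp R N x y⟩

theorem one_def : (1 : TensorRing R N) = of R N 0 (pow0 R N 1) := rfl
theorem mul_def (x y : TensorRing R N) : x * y = mulOp R N x y := rfl

theorem mulOp_mul (x y : TensorRing R N) : mulOp R N (x * y) = mulOp R N x * mulOp R N y := by
  rw [mul_def]
  induction x using induction with
  | zero => simp
  | of i x =>
    induction i with
    | zero =>
      obtain ⟨x, rfl⟩ := pow0_surjective R N x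
      rw [mulOp_of_zero, scalarOp_apply, mulOp_smul]
    | succ i ih =>
      induction x using pow_succ_induction with
      | zero => simp
      | tmul n x => rw [mulOp_of_cons, Module.End.mul_apply, mulOp_consOp, ih, mul_assoc]
      | add x y hx hy => rw [map_add, map_add, LinearMap.add_apply, map_add, hx, hy, add_mul]
  | add x y hx hy => rw [map_add, LinearMap.add_apply, map_add, hx, hy, add_mul]

instance : Ring (TensorRing R N) :=
  { (inferInstance : AddCommGroup (TensorRing R N)) with
    mul := fun x y => mulOp R N x y
    one := of R N 0 (pow0 R N 1)
    mul_assoc := fun x y z => by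
      change mulOp R N (x * y) z = _
      rw [mulOp_mul]; rfl
    one_mul := fun x => by
      rw [mul_def, one_def, mulOp_of_zero, scalarOp_apply, one_smul]
    mul_one := fun x => by
      rw [mul_def]
      induction x using induction with
      | zero => simp
      | of i x =>
        induction i with
        | zero =>
          obtain ⟨x, rfl⟩ := pow0_surjective R N x
          rw [mulOp_of_zero, scalarOp_apply, one_def, ← of_smul, ← pow0_smul, mul_one]
        | succ i ih =>
          induction x using pow_succ_induction with
          | zero => simp
          | tmul n x => rw [mulOp_of_cons, Module.End.mul_apply, ih, consOp_of]
          | add x y hx hy => rw [map_add, map_add, LinearMap.add_apply, hx, hy]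
      | add x y hx hy => rw [map_add, LinearMap.add_apply, hx, hy]
    zero_mul := fun x => by rw [mul_def, map_zero, LinearMap.zero_apply]
    mul_zero := fun x => by rw [mul_def, map_zero]
    left_distrib := fun x y z => by simp only [mul_def, map_add]
    right_distrib := fun x y z => by simp only [mul_def, map_add, LinearMap.add_apply]
    zsmul := fun n x => n • x
    nsmul := fun n x => n • x
    nsmul_zero := fun x => zero_smul ℕ x
    nsmul_succ := fun n x => succ_nsmul x n
    zsmul_zero' := fun x => zero_smul ℤ x
    zsmul_succ' := fun n x => SubNegMonoid.zsmul_succ' n x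
    zsmul_neg' := fun n x => SubNegMonoid.zsmul_neg' n x }

instance : SMulCommClass (TensorRing R N) Rᵐᵒᵖ (TensorRing R N) :=
  ⟨fun t r z => (mulOp R N t).map_smul r z⟩

/-- The ring homomorphism `R → T_R(N)`, the inclusion of `N⁰ = R`. -/
def incl : R →+* TensorRing R N where
  toFun r := of R N 0 (pow0 R N r)
  map_one' := rfl
  map_mul' r s := by
    rw [mul_def, mulOp_of_zero, scalarOp_apply, ← of_smul, ← pow0_smul]
  map_zero' := by simp
  map_add' r s := by simp

theorem incl_mul (r : R) (z : TensorRing R N) : incl R N r * z = r • z := by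
  rw [mul_def]; exact congrArg (fun f => f z) (mulOp_of_zero R N r)

theorem mul_incl (z : TensorRing R N) (r : R) : z * incl R N r = MulOpposite.op r • z := by
  have : incl R N r = MulOpposite.op r • (1 : TensorRing R N) := by
    rw [one_def, ← of_op_smul, ← pow0_op_smul, one_mul]; rfl
  rw [this, ← smul_eq_mul, smul_comm, smul_eq_mul, mul_one]

/-- The inclusion `M' → T_R(N)`. -/
def posIncl : PosPart R N →+ TensorRing R N :=
  DirectSum.toAddMonoid (fun i => of R N (i + 1))

theorem posIncl_smul (r : R) (m : PosPart R N) : posIncl R N (r • m) = r • posIncl R N m := by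
  induction m using DirectSum.induction_on with
  | zero => simp
  | of i x =>
    rw [← DirectSum.lof_eq_of R, ← map_smul, DirectSum.lof_eq_of, DirectSum.lof_eq_of]
    simp [posIncl, of_smul]
  | add x y hx hy => rw [smul_add, map_add, map_add, smul_add, hx, hy]

theorem posIncl_op_smul (r : Rᵐᵒᵖ) (m : PosPart R N) :
    posIncl R N (r • m) = r • posIncl R N m := by
  induction m using DirectSum.induction_on with
  | zero => simp
  | of i x =>
    rw [← DirectSum.lof_eq_of Rᵐᵒᵖ, ← map_smul, DirectSum.lof_eq_of, DirectSum.lof_eq_of]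
    simp [posIncl, of_op_smul]
  | add x y hx hy => rw [smul_add, map_add, map_add, smul_add, hx, hy]

end TensorRing

/-! ### The functors `l = T_R(N) ⊗_R -`, `e` and `q = Coker` -/

/-- `l(Y) = T_R(N) ⊗_R Y`, a left `T_R(N)`-module. -/
def lObj (Y : ModuleCat.{u} R) : ModuleCat.{u} (TensorRing R N) :=
  ModuleCat.of (TensorRing R N) (BalTensor R (TensorRing R N) Y)

/-- `e(X, α) = X`: restriction of scalars along `R → T_R(N)`. -/
def eFunctor : ModuleCat.{u} (TensorRing R N) ⥤ ModuleCat.{u} R :=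
  ModuleCat.restrictScalars (TensorRing.incl R N)

variable {R N}

/-- The action of `M'` on a left `T_R(N)`-module, as a biadditive map. -/
def posAct (X : ModuleCat.{u} (TensorRing R N)) :
    PosPart R N →+ (eFunctor R N).obj X →+ (eFunctor R N).obj X :=
  (smulAddHom (TensorRing R N) X).comp (TensorRing.posIncl R N)

theorem posAct_apply (X : ModuleCat.{u} (TensorRing R N)) (m : PosPart R N) (x : X) :
    posAct X m x = TensorRing.posIncl R N m • x := rfl

theorem posAct_balanced (X : ModuleCat.{u} (TensorRing R N)) (m : PosPart R N) (r : R)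
    (x : (eFunctor R N).obj X) : posAct X (MulOpposite.op r • m) x = posAct X m (r • x) := by
  change TensorRing.posIncl R N (MulOpposite.op r • m) • (show X from x) =
    TensorRing.posIncl R N m • (TensorRing.incl R N r • (show X from x))
  rw [smul_smul, TensorRing.mul_incl, TensorRing.posIncl_op_smul]

theorem posAct_smul (X : ModuleCat.{u} (TensorRing R N)) (r : R) (m : PosPart R N)
    (x : (eFunctor R N).obj X) : posAct X (r • m) x = r • posAct X m x := by
  change TensorRing.posIncl R N (r • m) • (show X from x) =
    TensorRing.incl R N r • (TensorRing.posIncl R N m • (show X from x))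
  rw [smul_smul, TensorRing.incl_mul, TensorRing.posIncl_smul]

/-- The structure map `α : M' ⊗_R X → X`, `m ⊗ x ↦ m x`, of a left `T_R(N)`-module, under the
identification of left modules over `T_R(N) = R ⊕ M'` with pairs `(X, α)`. -/
def actionMap (X : ModuleCat.{u} (TensorRing R N)) :
    BalTensor R (PosPart R N) ((eFunctor R N).obj X) →ₗ[R] (eFunctor R N).obj X where
  toFun := BalTensor.lift (posAct X) (posAct_balanced X)
  map_add' := map_add _
  map_smul' r z := by
    induction z using BalTensor.induction with
    | zero => rw [smul_zero, map_zero, smul_zero]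
    | tmul m x =>
      rw [BalTensor.smul_tmul, BalTensor.lift_tmul, BalTensor.lift_tmul, posAct_smul,
        RingHom.id_apply]
    | add x y hx hy => rw [smul_add, map_add, map_add, hx, hy, smul_add]

theorem actionMap_tmul (X : ModuleCat.{u} (TensorRing R N)) (m : PosPart R N) (x : X) :
    actionMap X (BalTensor.tmul R (B := (eFunctor R N).obj X) m x) =
      TensorRing.posIncl R N m • x :=
  BalTensor.lift_tmul (posAct X) (posAct_balanced X) m x

/-- `Coker(α)`, a left `R`-module. -/
def cokerObj (X : ModuleCat.{u} (TensorRing R N)) : ModuleCat.{u} R :=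
  ModuleCat.of R ((eFunctor R N).obj X ⧸ LinearMap.range (actionMap X))

theorem range_actionMap_le {X X' : ModuleCat.{u} (TensorRing R N)} (f : X ⟶ X') :
    LinearMap.range (actionMap X) ≤
      (LinearMap.range (actionMap X')).comap ((eFunctor R N).map f).hom := by
  rintro _ ⟨z, rfl⟩
  induction z using BalTensor.induction with
  | zero => simp
  | tmul m x =>
    refine ⟨BalTensor.tmul R (B := (eFunctor R N).obj X') m (f.hom x), ?_⟩
    exact (actionMap_tmul X' m (f.hom x)).trans
      (((congrArg f.hom (actionMap_tmul X m x)).trans (f.hom.map_smul _ _)).symm)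
  | add x y hx hy => rw [map_add]; exact add_mem hx hy

variable (R N)

/-- The functor `q`, with `q(X, α) = Coker(α)`; on morphisms it is the induced map on cokernels. -/
def qFunctor : ModuleCat.{u} (TensorRing R N) ⥤ ModuleCat.{u} R where
  obj X := cokerObj X
  map f := ModuleCat.ofHom (Submodule.mapQ _ _ ((eFunctor R N).map f).hom (range_actionMap_le f))
  map_id X := by
    ext x
    rfl
  map_comp f g := by
    ext x
    rfl

end TensorRing

end TensorRingSilting

end

noncomputable section

namespace TensorRingSilting

/-! ### Transfer of (partial) silting objects along a left adjoint -/

section Adjunction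

/-! The functor `q` has a right adjoint `z`, which sends `Y` to `(Y, 0)`: restriction of scalars
along the augmentation `T → R` that kills `M'`. Everything follows formally from this adjunction.

Under it, `Hom(q δ, Y)` becomes `Hom(δ, z Y)`, so `𝒟_{q δ}` is the preimage of `𝒟_δ` under `z`
(`classD_map_leftAdjoint`). Being a left adjoint, `q` is right exact; as `z` preserves epimorphisms,
`q` preserves projectives. So `q` carries a projective presentation to a projective presentation.

Restriction of scalars also has a right adjoint, coextension, so `z` is exact and preserves
coproducts. Hence preimages of torsion classes under `z` are torsion classes. The unit `X → z q X`
is the projection onto `Coker(α)`, hence epi, so `z q X` lies in `𝒟_δ` whenever `X` does. This gives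
the partial silting case.

For silting it remains to see that `Gen(q X)` is the preimage of `Gen(X)` under `z`. One inclusion
applies `z` and uses that the unit at `X` is epi; the other applies `q` and uses that the counit is
epi. -/

theorem classD_map_leftAdjoint {C : Type*} [Category* C] {D : Type*} [Category* D]
    -- The hom-set bijections of the adjunction are natural in the first variable, so they conjugate
    -- precomposition with `F.map σ` into precomposition with `σ`; surjectivity is unaffected.
    {F : C ⥤ D} {G : D ⥤ C} (adj : F ⊣ G) {P₁ P₀ : C} (σ : P₁ ⟶ P₀) :
    classD (F.map σ) = (classD σ).inverseImage G := by
  ext Y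
  have key : (adj.homEquiv P₁ Y) ∘ (fun g : F.obj P₀ ⟶ Y => F.map σ ≫ g) =
      (fun g : P₀ ⟶ G.obj Y => σ ≫ g) ∘ (adj.homEquiv P₀ Y) := by
    ext g
    exact adj.homEquiv_naturality_left σ g
  change Function.Surjective _ ↔ Function.Surjective _
  rw [← (adj.homEquiv P₁ Y).comp_surjective, key, (adj.homEquiv P₀ Y).surjective_comp]

variable {C : Type*} [Category* C] [Abelian C] {D : Type*} [Category* D] [Abelian D]
  {F : C ⥤ D} {G : D ⥤ C}

/-- A left adjoint preserves cokernels, and it preserves projectives once its right adjoint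
preserves epimorphisms. -/
theorem IsProjectivePresentation.map_leftAdjoint (adj : F ⊣ G) [G.PreservesEpimorphisms]
    [F.PreservesZeroMorphisms] {P₁ P₀ X : C} {σ : P₁ ⟶ P₀} {π : P₀ ⟶ X}
    (h : IsProjectivePresentation σ π) :
    IsProjectivePresentation (F.map σ) (F.map π) := by
  have := h.epi
  have := adj.leftAdjoint_preservesColimits.{0, 0}
  refine ⟨adj.map_projective _ h.projective₁, adj.map_projective _ h.projective₀,
    inferInstance, by rw [← F.map_comp, h.zero, F.map_zero], ?_⟩
  exact h.exact.map_of_epi_of_preservesCokernel F h.epi inferInstance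

/-- Each closure property is tested after applying `G`, which preserves epimorphisms, short exact
sequences and coproducts. -/
theorem IsTorsionClass.inverseImage {𝒯 : ObjectProperty C} (h : IsTorsionClass.{w} 𝒯)
    (G : D ⥤ C) [G.PreservesZeroMorphisms] [PreservesFiniteLimits G] [PreservesFiniteColimits G]
    [∀ J : Type w, PreservesColimitsOfShape (Discrete J) G] :
    IsTorsionClass.{w} (𝒯.inverseImage G) := by
  have := h.quotients
  have := h.extensions
  have := h.coproducts
  exact ⟨⟨fun f _ hX => 𝒯.prop_of_epi (G.map f) hX⟩, inferInstance, fun J => inferInstance⟩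

theorem IsPartialSilting.map_leftAdjoint (adj : F ⊣ G) [F.PreservesZeroMorphisms]
    [G.PreservesZeroMorphisms] [PreservesFiniteLimits G] [PreservesFiniteColimits G]
    [∀ J : Type w, PreservesColimitsOfShape (Discrete J) G]
    {P₁ P₀ X : C} {σ : P₁ ⟶ P₀} (h : IsPartialSilting.{w} σ X) [Epi (adj.unit.app X)] :
    IsPartialSilting.{w} (F.map σ) (F.obj X) := by
  obtain ⟨π, hπ⟩ := h.presentation
  refine ⟨⟨F.map π, hπ.map_leftAdjoint adj⟩, ?_, ?_⟩
  · rw [classD_map_leftAdjoint adj]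
    have := h.torsion.quotients
    -- The unit exhibits `G (F X)` as a quotient of `X`, and a torsion class is closed under
    -- quotients.
    exact (classD σ).prop_of_epi (adj.unit.app X) h.mem
  · rw [classD_map_leftAdjoint adj]
    exact h.torsion.inverseImage G

theorem IsSilting.map_leftAdjoint [HasCoproducts.{w} C] [HasCoproducts.{w} D] (adj : F ⊣ G)
    [F.PreservesZeroMorphisms] [G.PreservesEpimorphisms]
    [∀ J : Type w, PreservesColimitsOfShape (Discrete J) G]
    {P₁ P₀ X : C} {σ : P₁ ⟶ P₀} (h : IsSilting.{w} σ X) [Epi (adj.unit.app X)]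
    [∀ Y, Epi (adj.counit.app Y)] :
    IsSilting.{w} (F.map σ) (F.obj X) := by
  obtain ⟨π, hπ⟩ := h.presentation
  refine ⟨⟨F.map π, hπ.map_leftAdjoint adj⟩, ?_⟩
  have := adj.leftAdjoint_preservesColimits.{w, w}
  rw [classD_map_leftAdjoint adj, ← h.gen_eq]
  ext Y
  constructor
  -- From `∐ F X ↠ Y`: the composite `∐ X ↠ ∐ G F X ≅ G (∐ F X) ↠ G Y`.
  · rintro ⟨J, f, hf⟩
    exact ⟨J, Limits.Sigma.map (fun _ => adj.unit.app X) ≫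
      (PreservesCoproduct.iso G (fun _ : J => F.obj X)).inv ≫ G.map f, inferInstance⟩
  -- From `∐ X ↠ G Y`: the composite `∐ F X ≅ F (∐ X) ↠ F G Y ↠ Y`.
  · rintro ⟨J, f, hf⟩
    have := Functor.preservesEpimorphisms_of_adjunction adj
    exact ⟨J, (PreservesCoproduct.iso F (fun _ : J => X)).inv ≫ F.map f ≫ adj.counit.app Y,
      inferInstance⟩

end Adjunction

/-! ### The augmentation of the tensor ring -/

section Augmentation

variable (R : Type u) [Ring R] (N : Type u) [AddCommGroup N] [Module R N] [Module Rᵐᵒᵖ N]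
  [SMulCommClass R Rᵐᵒᵖ N]

namespace TensorRing

/-- The components of the augmentation: the identity of `N⁰ = R`, and zero on `Nⁱ⁺¹`. -/
def augmentationComponent : ∀ i, TPow R N i →+ R
  | 0 => AddMonoidHom.id R
  | _ + 1 => 0

/-- The projection `T_R(N) = R ⊕ M' → R`, as an additive map. -/
def augmentationAdd : TensorRing R N →+ R := lift R N (augmentationComponent R N)

theorem augmentationAdd_of_zero (r : R) :
    augmentationAdd R N (of R N 0 (pow0 R N r)) = r :=
  lift_of R N (augmentationComponent R N) 0 (pow0 R N r)

theorem augmentationAdd_of_succ (i : ℕ) (x : TPow R N (i + 1)) :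
    augmentationAdd R N (of R N (i + 1) x) = 0 :=
  lift_of R N (augmentationComponent R N) (i + 1) x

theorem augmentationAdd_smul (r : R) (z : TensorRing R N) :
    augmentationAdd R N (r • z) = r * augmentationAdd R N z := by
  induction z using induction with
  | zero => simp
  | of i x =>
    rw [← of_smul]
    cases i with
    | zero =>
      obtain ⟨x, rfl⟩ := pow0_surjective R N x
      rw [← pow0_smul, augmentationAdd_of_zero, augmentationAdd_of_zero]
    | succ i => rw [augmentationAdd_of_succ, augmentationAdd_of_succ, mul_zero]
  | add x y hx hy => rw [smul_add, map_add, map_add, mul_add, hx, hy]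

/-- Concatenation with `n` raises the degree by one, so its image lies in positive degrees. This is
what makes the augmentation multiplicative. -/
theorem augmentationAdd_consOp (n : N) (z : TensorRing R N) :
    augmentationAdd R N (consOp R N n z) = 0 := by
  induction z using induction with
  | zero => simp
  | of i x => rw [consOp_of, augmentationAdd_of_succ]
  | add x y hx hy => rw [map_add, map_add, hx, hy, add_zero]

/-- The augmentation `T_R(N) → R`, the projection onto `N⁰ = R`. -/
def augmentation : TensorRing R N →+* R where
  toFun := augmentationAdd R N
  map_zero' := map_zero _
  map_add' := map_add _
  map_one' := augmentationAdd_of_zero R N 1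
  map_mul' x y := by
    induction x using induction with
    | zero => simp
    | of i x =>
      cases i with
      | zero =>
        obtain ⟨x, rfl⟩ := pow0_surjective R N x
        rw [mul_def, mulOp_of_zero, scalarOp_apply, augmentationAdd_smul,
          augmentationAdd_of_zero]
      | succ i =>
        -- A positive-degree `x` is a sum of tensors `n ⊗ x'`, and `(n ⊗ x') y = n ⊗ (x' y)` again
        -- has only positive-degree terms.
        rw [augmentationAdd_of_succ, zero_mul, mul_def]
        induction x using pow_succ_induction with
        | zero => simp
        | tmul n x => rw [mulOp_of_cons, Module.End.mul_apply, augmentationAdd_consOp]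
        | add x x' hx hx' =>
          rw [map_add, map_add, LinearMap.add_apply, map_add, hx, hx', add_zero]
    | add x x' hx hx' => rw [add_mul, map_add, map_add, add_mul, hx, hx']

theorem augmentation_incl (r : R) : augmentation R N (incl R N r) = r :=
  augmentationAdd_of_zero R N r

theorem posIncl_of (i : ℕ) (x : TPow R N (i + 1)) :
    posIncl R N (DirectSum.of (fun i => TPow R N (i + 1)) i x) = of R N (i + 1) x :=
  DirectSum.toAddMonoid_of (fun i => of R N (i + 1)) i x

theorem augmentation_posIncl (m : PosPart R N) : augmentation R N (posIncl R N m) = 0 := by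
  induction m using DirectSum.induction_on with
  | zero => simp
  | of i x => rw [posIncl_of]; exact augmentationAdd_of_succ R N i x
  | add x y hx hy => rw [map_add, map_add, hx, hy, add_zero]

/-- The decomposition `T = R ⊕ M'` at the level of elements; it reduces `T`-linearity of the
projection onto `Coker(α)` to the action of `M'`. -/
theorem exists_eq_incl_add_posIncl (t : TensorRing R N) :
    ∃ m, t = incl R N (augmentation R N t) + posIncl R N m := by
  induction t using induction with
  | zero => exact ⟨0, by simp⟩
  | of i x =>
    cases i with
    | zero =>
      obtain ⟨x, rfl⟩ := pow0_surjective R N x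
      refine ⟨0, ?_⟩
      rw [map_zero, add_zero]
      exact congrArg (incl R N) (augmentationAdd_of_zero R N x).symm
    | succ i =>
      refine ⟨DirectSum.of (fun i => TPow R N (i + 1)) i x, ?_⟩
      rw [posIncl_of, show augmentation R N (of R N (i + 1) x) = 0 from
        augmentationAdd_of_succ R N i x, map_zero, zero_add]
  | add x y hx hy =>
    obtain ⟨m, hm⟩ := hx
    obtain ⟨m', hm'⟩ := hy
    refine ⟨m + m', ?_⟩
    rw [map_add, map_add, map_add, add_add_add_comm, ← hm, ← hm']

end TensorRing

/-! ### The functor `q` is left adjoint to `Y ↦ (Y, 0)` -/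

/-- The functor `Y ↦ (Y, 0)`: restriction of scalars along the augmentation. -/
def zFunctor : ModuleCat.{u} R ⥤ ModuleCat.{u} (TensorRing R N) :=
  ModuleCat.restrictScalars (TensorRing.augmentation R N)

/-- The quotient map `(X, α) → (Coker(α), 0)`. -/
def cokerProj (X : ModuleCat.{u} (TensorRing R N)) :
    X ⟶ (zFunctor R N).obj ((qFunctor R N).obj X) :=
  ModuleCat.ofHom (Y := (zFunctor R N).obj ((qFunctor R N).obj X))
    { toFun := fun x => (LinearMap.range (actionMap X)).mkQ x
      map_add' := fun x y => map_add (LinearMap.range (actionMap X)).mkQ x y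
      map_smul' := fun t x => by
        obtain ⟨m, hm⟩ := TensorRing.exists_eq_incl_add_posIncl R N t
        have h : t • x = TensorRing.incl R N (TensorRing.augmentation R N t) • x +
            TensorRing.posIncl R N m • x := by
          rw [← add_smul, ← hm]
        -- `T` acts on the target through the augmentation, so `t x` is compared with the action of
        -- the degree-zero part of `t`. The difference is `m x = α(m ⊗ x)`.
        refine (Submodule.Quotient.eq (LinearMap.range (actionMap X))
          (x := t • x) (y := TensorRing.incl R N (TensorRing.augmentation R N t) • x)).2
          ⟨BalTensor.tmul R (B := (eFunctor R N).obj X) m x, ?_⟩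
        refine (actionMap_tmul X m x).trans ?_
        exact (sub_eq_of_eq_add' h).symm }

theorem actionMap_zFunctor (Y : ModuleCat.{u} R) : actionMap ((zFunctor R N).obj Y) = 0 := by
  ext z
  induction z using BalTensor.induction with
  | zero => simp
  | tmul m y =>
    refine (actionMap_tmul ((zFunctor R N).obj Y) m y).trans ?_
    change TensorRing.augmentation R N (TensorRing.posIncl R N m) • (show Y from y) = 0
    rw [TensorRing.augmentation_posIncl, zero_smul]
  | add x y hx hy => rw [map_add, hx, hy, map_add]

/-- The canonical map `Coker(0 : M' ⊗ Y → Y) → Y`. -/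
def cokerDesc (Y : ModuleCat.{u} R) : (qFunctor R N).obj ((zFunctor R N).obj Y) ⟶ Y :=
  ModuleCat.ofHom (Submodule.liftQ (LinearMap.range (actionMap ((zFunctor R N).obj Y)))
    { toFun := fun y => y
      map_add' := fun _ _ => rfl
      map_smul' := fun r y => by
        -- On the source, `r` acts through `R → T → R`, which is the identity only by
        -- `augmentation_incl`.
        change TensorRing.augmentation R N (TensorRing.incl R N r) • (show Y from y) = _
        rw [TensorRing.augmentation_incl]
        rfl }
    (by rw [actionMap_zFunctor, LinearMap.range_zero]; exact bot_le))

/-- The functor `q` is left adjoint to `Y ↦ (Y, 0)`. -/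
def qzAdjunction : qFunctor R N ⊣ zFunctor R N :=
  Adjunction.mkOfUnitCounit
    { unit := { app := cokerProj R N, naturality := fun _ _ _ => rfl }
      counit :=
        { app := cokerDesc R N
          naturality := fun X Y f => by
            apply ModuleCat.hom_ext
            apply Submodule.linearMap_qext
            rfl }
      left_triangle := by
        ext X : 2
        apply ModuleCat.hom_ext
        apply Submodule.linearMap_qext
        rfl
      right_triangle := by
        ext Y : 2
        rfl }

instance (X : ModuleCat.{u} (TensorRing R N)) : Epi ((qzAdjunction R N).unit.app X) :=
  (ModuleCat.epi_iff_surjective (cokerProj R N X)).2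
    (LinearMap.range (actionMap X)).mkQ_surjective

instance (Y : ModuleCat.{u} R) : Epi ((qzAdjunction R N).counit.app Y) :=
  (ModuleCat.epi_iff_surjective (cokerDesc R N Y)).2 fun y =>
    ⟨(LinearMap.range (actionMap ((zFunctor R N).obj Y))).mkQ y, rfl⟩

instance : (zFunctor R N).Additive :=
  inferInstanceAs (ModuleCat.restrictScalars (TensorRing.augmentation R N)).Additive

instance : (qFunctor R N).Additive := (qzAdjunction R N).left_adjoint_additive

/-- Coextension of scalars is a right adjoint of `zFunctor`. With the left adjoint `qFunctor` on the
other side, `zFunctor` preserves both limits and colimits. -/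
instance : (zFunctor R N).IsLeftAdjoint :=
  (ModuleCat.restrictCoextendScalarsAdj.{u, u, u} (TensorRing.augmentation R N)).isLeftAdjoint

instance : (zFunctor R N).IsRightAdjoint := (qzAdjunction R N).isRightAdjoint

end Augmentation

end TensorRingSilting

end
open TensorRingSilting in
theorem corollary4p5 {R : Type u} [Ring R] [Nontrivial R]
    {N : Type u} [AddCommGroup N] [Module R N] [Module Rᵐᵒᵖ N] [SMulCommClass R Rᵐᵒᵖ N]
    (P₁ P₀ : ModuleCat.{u} R) (X : ModuleCat.{u} (TensorRing R N))
    (δ : lObj R N P₁ ⟶ lObj R N P₀) (π : lObj R N P₀ ⟶ X)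
    (h : IsProjectivePresentation δ π) :
    (IsPartialSilting.{u} δ X → IsPartialSilting.{u} ((qFunctor R N).map δ) (cokerObj X)) ∧
    (IsSilting.{u} δ X → IsSilting.{u} ((qFunctor R N).map δ) (cokerObj X)) := by
  -- Coproducts indexed by `J : Type u` need the colimits of universe `u`; exactness needs only the
  -- finite shapes, taken in universe `0`.
  have := (Adjunction.ofIsLeftAdjoint (zFunctor R N)).leftAdjoint_preservesColimits.{u, u}
  have := (Adjunction.ofIsLeftAdjoint (zFunctor R N)).leftAdjoint_preservesColimits.{0, 0}
  have := (qzAdjunction R N).rightAdjoint_preservesLimits.{0, 0}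
  exact ⟨fun hX => hX.map_leftAdjoint (qzAdjunction R N),
    fun hX => hX.map_leftAdjoint (qzAdjunction R N)⟩
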